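/- A metric space $(X,d)$ is geodesic if every two points $x,y \in X$ are joined by a geodesic, that is, by an isometry $\gamma\colon[0,d(x,y)]\to X$ with $\gamma(0)=x$ and $\gamma(d(x,y))=y$. A Hadamard space is a complete geodesic metric space that is CAT(0): in every geodesic triangle, distances between points on its sides are no larger than the corresponding distances in a Euclidean triangle with the same side lengths. In such a space, geodesics between given points are unique, and for $p,q\neq x$ we write $\angle pxq$ for the Alexandrov angle at $x$ between the geodesics $\gamma$ from $x$ to $p$ and $\delta$ from $x$ to $q$, namely $$\angle pxq=\limsup_{s,t\downarrow 0}\overline{\angle}_x(\gamma(s),\delta(t)),$$ where $\overline{\angle}_x(u,v)$ is the angle, at the vertex corresponding to $x$, of a Euclidean triangle with side lengths $d(x,u)$, $d(x,v)$, $d(u,v)$. Let $A$ be a nonempty finite subset of a Hadamard space $(X,d)$. The mean deficit of $A$ at a point $x\in X\setminus A$ is $$\mathrm{def}_A(x)=\max\Big\{\sup_{y\neq x}\ \min_{a\in A}\ d(a,x)\cos\angle axy,\ 0\Big\}.$$ The mean set $\mathrm{mean}(A)$ is the set of all points $\bar x\in X$ for which there are weights $w_a\ge 0$ $(a\in A)$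 with $\sum_{a\in A}w_a=1$ such that $\bar x$ minimizes $\sum_{a\in A}w_a\,d(a,x)^2$ over $x\in X$. **Proposition (Mean deficit and proximity to the mean set).** Let $A$ be a nonempty finite subset of a locally compact Hadamard space $X$. For any sequence $(x_r)$ in $X\setminus A$, $$\mathrm{def}_A(x_r)\to 0\quad\Longrightarrow\quad \mathrm{dist}\big(x_r,\mathrm{mean}(A)\big)\to 0,$$ where $\mathrm{dist}(x,S)=\inf_{s\in S}d(x,s)$ (equal to $+\infty$ if $S=\emptyset$). -/

import Mathlib

open Filter Topology

noncomputable section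

namespace HadamardMean

/-- `γ`, restricted to `[0, d(x, y)]`, is a geodesic from `x` to `y`: an isometry of that interval
into `X` with the given endpoints. Values of `γ` elsewhere are irrelevant. -/
structure IsGeodesic {X : Type*} [MetricSpace X] (γ : ℝ → X) (x y : X) : Prop where
  source : γ 0 = x
  target : γ (dist x y) = y
  isometry : ∀ s ∈ Set.Icc 0 (dist x y), ∀ t ∈ Set.Icc 0 (dist x y), dist (γ s) (γ t) = |s - t|

/-- Every two points are joined by a geodesic. -/
def IsGeodesicSpace (X : Type*) [MetricSpace X] : Prop :=
  ∀ x y : X, ∃ γ : ℝ → X, IsGeodesic γ x y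

/-- A geodesic space is CAT(0) if, in every geodesic triangle, distances between points on the sides
are no larger than the corresponding distances in a comparison triangle in the Euclidean plane.
Since `p, q, r` are arbitrary, it is enough to compare points of two sides that start at `p`
(the two points `γ u` and `δ v` correspond to `x'` and `y'`); for two points on
the same side the two distances are always equal. -/
structure IsCAT0 (X : Type*) [MetricSpace X] : Prop where
  geodesic : IsGeodesicSpace X
  comparison : ∀ (p q r : X) (γ δ : ℝ → X), IsGeodesic γ p q → IsGeodesic δ p r →
    ∀ p' q' r' : EuclideanSpace ℝ (Fin 2),
      dist p' q' = dist p q → dist p' r' = dist p r → dist q' r' = dist q r →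
    ∀ u ∈ Set.Icc 0 (dist p q), ∀ v ∈ Set.Icc 0 (dist p r),
    ∀ x' ∈ segment ℝ p' q', ∀ y' ∈ segment ℝ p' r', dist p' x' = u → dist p' y' = v →
      dist (γ u) (δ v) ≤ dist x' y'

/-- A Hadamard space is a complete CAT(0) space. -/
structure IsHadamardSpace (X : Type*) [MetricSpace X] : Prop where
  complete : CompleteSpace X
  cat0 : IsCAT0 X

/-- The comparison angle at `x` of the points `p, q ≠ x`: the angle at the vertex corresponding
to `x` in a Euclidean triangle with the same side lengths, by the law of cosines. -/
def comparisonAngle {X : Type*} [MetricSpace X] (p x q : X) : ℝ :=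
  Real.arccos ((dist x p ^ 2 + dist x q ^ 2 - dist p q ^ 2) / (2 * dist x p * dist x q))

/-- The Alexandrov angle between two geodesics `γ, δ` issuing from a common point: the upper limit,
as `s` and `t` decrease to `0`, of the comparison angle of `γ s` and `δ t`. -/
def pathAngle {X : Type*} [MetricSpace X] (γ δ : ℝ → X) : ℝ :=
  limsup (fun p : ℝ × ℝ => comparisonAngle (γ p.1) (γ 0) (δ p.2)) (𝓝[>] (0 : ℝ) ×ˢ 𝓝[>] (0 : ℝ))

open Classical in
/-- The geodesic from `x` to `y` (unique on `[0, d(x, y)]` in a CAT(0) space). -/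
def geodesicPath {X : Type*} [MetricSpace X] (x y : X) : ℝ → X :=
  if h : ∃ γ : ℝ → X, IsGeodesic γ x y then h.choose else fun _ => x

/-- The angle `∠ p x q` in a CAT(0) space, for `p, q ≠ x`: the Alexandrov angle between
the geodesics from `x` to `p` and from `x` to `q`. -/
def angle {X : Type*} [MetricSpace X] (p x q : X) : ℝ :=
  pathAngle (geodesicPath x p) (geodesicPath x q)

/-- The mean deficit of the nonempty finite set `A` at a point `x` (meaningful for `x ∉ A`):
the positive part of `sup_{y ≠ x} min_{a ∈ A} d(a, x) cos ∠ a x y`.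
The supremum is over a nonempty set of reals bounded by `max_{a ∈ A} d(a, x)` when `x ∉ A`. -/
def meanDeficit {X : Type*} [MetricSpace X] (A : Finset X) (hA : A.Nonempty) (x : X) : ℝ :=
  max (⨆ y : {y : X // y ≠ x}, A.inf' hA fun a => dist a x * Real.cos (angle a x y)) 0

/-- The mean set of `A`: the set of barycenters, that is, of minimizers over the whole space
of `∑ a, w a * d(a, ·)²` for weights `w` in the simplex of `A`. -/
def meanSet {X : Type*} [MetricSpace X] (A : Finset X) : Set X :=
  {x | ∃ w ∈ stdSimplex ℝ A,
    ∀ y : X, ∑ a : A, w a * dist (a : X) x ^ 2 ≤ ∑ a : A, w a * dist (a : X) y ^ 2}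

end HadamardMean

end

/-! In fact a point `x ∉ A` with mean deficit `ε` lies within `2 * ε` of the mean set. The CAT(0)
law of cosines (`IsCAT0.law_cos`) gives, for every `y`, some `a ∈ A` with `d(a,y)² ≥ d(a,x)² +
d(x,y)² - 2 ε d(x,y) ≥ d(a,x)² - ε²`. So the functions `d(a,·)² - d(a,x)² + ε²` are nowhere all
negative. They are convex along geodesics, and Hahn-Banach separation (`exists_weights_nonneg`)
makes one convex combination of them nonnegative: `x` minimizes `F = ∑ w_a d(a,·)²` up to `ε²`.
Completeness and uniform convexity of `F` yield a true minimizer `z`, which lies in the mean set,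
and uniform convexity again bounds `d(x,z)`. -/

namespace HadamardMean

/-! ### Euclidean comparison triangles -/

section ComparisonTriangle

/-- Three nonnegative reals satisfying the triangle inequalities are the side lengths of a triangle
in the Euclidean plane with one vertex at the origin. -/
theorem exists_planar_triangle {a b c : ℝ} (ha : 0 ≤ a) (hb : 0 ≤ b) (hc : 0 ≤ c)
    (hab : a ≤ b + c) (hba : b ≤ a + c) (hcab : c ≤ a + b) :
    ∃ q r : EuclideanSpace ℝ (Fin 2), ‖q‖ = a ∧ ‖r‖ = b ∧ ‖q - r‖ = c := by
  rcases ha.eq_or_lt with rfl | ha'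
  · have hbc : b = c := by linarith
    subst hbc
    exact ⟨0, EuclideanSpace.single 0 b, by simp, by simp [abs_of_nonneg hb],
      by simp [abs_of_nonneg hb]⟩
  -- With `q = (a, 0)`, the law of cosines forces `k` as the first coordinate of `r`.
  · set k : ℝ := (a ^ 2 + b ^ 2 - c ^ 2) / (2 * a) with hk
    have hak : 2 * a * k = a ^ 2 + b ^ 2 - c ^ 2 := by rw [hk]; field_simp
    have h1 : k ≤ b := by
      rw [hk, div_le_iff₀ (by positivity)]
      nlinarith [mul_nonneg (sub_nonneg.2 hab) (sub_nonneg.2 hba)]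
    have h2 : -b ≤ k := by
      rw [hk, le_div_iff₀ (by positivity)]
      nlinarith
    have hs : Real.sqrt (b ^ 2 - k ^ 2) ^ 2 = b ^ 2 - k ^ 2 :=
      Real.sq_sqrt (by nlinarith)
    refine ⟨!₂[a, 0], !₂[k, Real.sqrt (b ^ 2 - k ^ 2)], ?_, ?_, ?_⟩
    · simp [EuclideanSpace.norm_eq, Fin.sum_univ_two, Real.sqrt_sq ha]
    · rw [EuclideanSpace.norm_eq, Real.sqrt_eq_iff_eq_sq (by positivity) hb]
      simp [Fin.sum_univ_two, hs]
    · rw [EuclideanSpace.norm_eq, Real.sqrt_eq_iff_eq_sq (by positivity) hc]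
      simp only [Fin.sum_univ_two, Real.norm_eq_abs, sq_abs]
      simp [hs]
      linarith

end ComparisonTriangle

/-! ### Convexity of squared distances, angles and the law of cosines -/

section CAT0

variable {X : Type*} [MetricSpace X]

/-- The CAT(0) inequality for points on two sides of a geodesic triangle, in coordinates. -/
theorem IsCAT0.dist_sq_le (hX : IsCAT0 X) {p q r : X} {γ δ : ℝ → X} (hγ : IsGeodesic γ p q)
    (hδ : IsGeodesic δ p r) {s t : ℝ} (hs : s ∈ Set.Icc (0 : ℝ) 1) (ht : t ∈ Set.Icc (0 : ℝ) 1) :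
    dist (γ (s * dist p q)) (δ (t * dist p r)) ^ 2 ≤
      s ^ 2 * dist p q ^ 2 + t ^ 2 * dist p r ^ 2 -
        s * t * (dist p q ^ 2 + dist p r ^ 2 - dist q r ^ 2) := by
  obtain ⟨q', r', hq, hr, hqr⟩ := exists_planar_triangle (a := dist p q) (b := dist p r)
    (c := dist q r) dist_nonneg dist_nonneg dist_nonneg
    (by linarith [dist_triangle p r q, dist_comm q r]) (dist_triangle p q r)
    (by linarith [dist_triangle q p r, dist_comm q p])
  have hmem : ∀ {u : ℝ}, u ∈ Set.Icc (0 : ℝ) 1 → ∀ v : EuclideanSpace ℝ (Fin 2),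
      u • v ∈ segment ℝ 0 v := fun {u} hu v =>
    ⟨1 - u, u, by linarith [hu.2], hu.1, by ring, by simp⟩
  have hle := hX.comparison p q r γ δ hγ hδ 0 q' r' (by simpa using hq) (by simpa using hr)
    (by rwa [dist_eq_norm]) (s * dist p q)
    ⟨mul_nonneg hs.1 dist_nonneg, mul_le_of_le_one_left dist_nonneg hs.2⟩ (t * dist p r)
    ⟨mul_nonneg ht.1 dist_nonneg, mul_le_of_le_one_left dist_nonneg ht.2⟩
    (s • q') (hmem hs q') (t • r') (hmem ht r')
    (by simp [norm_smul, hq, abs_of_nonneg hs.1]) (by simp [norm_smul, hr, abs_of_nonneg ht.1])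
  refine (pow_le_pow_left₀ dist_nonneg hle 2).trans_eq ?_
  have h1 := norm_sub_sq_real q' r'
  rw [dist_eq_norm, norm_sub_sq_real, norm_smul, norm_smul, inner_smul_left, inner_smul_right,
    Real.norm_of_nonneg hs.1, Real.norm_of_nonneg ht.1, hq, hr]
  rw [hq, hr, hqr] at h1
  simp only [conj_trivial]
  linear_combination (-(s * t)) * h1

/-- Squared distance functions are uniformly convex along geodesics of a CAT(0) space. -/
theorem IsCAT0.exists_dist_sq_le (hX : IsCAT0 X) (y z : X) {t : ℝ}
    (ht : t ∈ Set.Icc (0 : ℝ) 1) :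
    ∃ m : X, ∀ p : X, dist p m ^ 2 ≤
      (1 - t) * dist p y ^ 2 + t * dist p z ^ 2 - t * (1 - t) * dist y z ^ 2 := by
  obtain ⟨γ, hγ⟩ := hX.geodesic y z
  refine ⟨γ (t * dist y z), fun p => ?_⟩
  obtain ⟨δ, hδ⟩ := hX.geodesic y p
  -- Hinge at `y`; parameter `1` on the second side selects its endpoint `p`.
  have h := hX.dist_sq_le hγ hδ ht (t := 1) (by simp)
  rw [one_mul, hδ.target] at h
  rw [dist_comm p, dist_comm p y, dist_comm p z]
  linarith

theorem IsGeodesic.dist_source {γ : ℝ → X} {x y : X} (h : IsGeodesic γ x y) {s : ℝ}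
    (hs : s ∈ Set.Icc 0 (dist x y)) : dist x (γ s) = s := by
  have := h.isometry 0 ⟨le_rfl, dist_nonneg⟩ s hs
  rwa [h.source, zero_sub, abs_neg, abs_of_nonneg hs.1] at this

/-- Comparison angles at the vertex of a hinge do not increase when its sides are shortened. -/
theorem IsCAT0.comparisonAngle_le (hX : IsCAT0 X) {x p q : X} {γ δ : ℝ → X}
    (hγ : IsGeodesic γ x p) (hδ : IsGeodesic δ x q) {s t : ℝ} (hs : s ∈ Set.Ioc 0 (dist x p))
    (ht : t ∈ Set.Ioc 0 (dist x q)) :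
    comparisonAngle (γ s) x (δ t) ≤ comparisonAngle p x q := by
  have hp : 0 < dist x p := hs.1.trans_le hs.2
  have hq : 0 < dist x q := ht.1.trans_le ht.2
  have hs0 := hs.1
  have ht0 := ht.1
  have h := hX.dist_sq_le hγ hδ (s := s / dist x p) (t := t / dist x q)
    ⟨by positivity, (div_le_one hp).2 hs.2⟩ ⟨by positivity, (div_le_one hq).2 ht.2⟩
  rw [div_mul_cancel₀ _ hp.ne', div_mul_cancel₀ _ hq.ne', div_pow, div_pow,
    div_mul_cancel₀ _ (by positivity), div_mul_cancel₀ _ (by positivity)] at h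
  unfold comparisonAngle
  rw [hγ.dist_source ⟨hs.1.le, hs.2⟩, hδ.dist_source ⟨ht.1.le, ht.2⟩]
  refine Real.arccos_le_arccos ?_
  rw [le_div_iff₀ (by positivity)]
  calc _ = s / dist x p * (t / dist x q) * (dist x p ^ 2 + dist x q ^ 2 - dist p q ^ 2) := by
        field_simp
    _ ≤ _ := by linarith

theorem comparisonAngle_mem_Icc (p x q : X) : comparisonAngle p x q ∈ Set.Icc 0 Real.pi :=
  ⟨Real.arccos_nonneg _, Real.arccos_le_pi _⟩

theorem pathAngle_nonneg (γ δ : ℝ → X) : 0 ≤ pathAngle γ δ := by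
  refine le_limsup_of_frequently_le (Frequently.of_forall fun _ =>
    (comparisonAngle_mem_Icc _ _ _).1) ?_
  exact isBoundedUnder_of ⟨Real.pi, fun _ => (comparisonAngle_mem_Icc _ _ _).2⟩

theorem geodesicPath_isGeodesic (hX : IsGeodesicSpace X) (x y : X) :
    IsGeodesic (geodesicPath x y) x y := by
  have h := hX x y
  rw [geodesicPath, dif_pos h]
  exact h.choose_spec

/-- Alexandrov angles in a CAT(0) space are bounded by comparison angles. -/
theorem IsCAT0.angle_le_comparisonAngle (hX : IsCAT0 X) {x p q : X} (hp : p ≠ x) (hq : q ≠ x) :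
    angle p x q ≤ comparisonAngle p x q := by
  have hγ := geodesicPath_isGeodesic hX.geodesic x p
  have hδ := geodesicPath_isGeodesic hX.geodesic x q
  refine limsup_le_of_le (isCoboundedUnder_le_of_le _ (x := 0) fun _ =>
    (comparisonAngle_mem_Icc _ _ _).1) ?_
  filter_upwards [prod_mem_prod (Ioc_mem_nhdsGT (dist_pos.2 hp.symm))
    (Ioc_mem_nhdsGT (dist_pos.2 hq.symm))] with u hu
  rw [hγ.source]
  exact hX.comparisonAngle_le hγ hδ hu.1 hu.2

/-- The triangle inequalities place the quotient in `[-1, 1]`, where `Real.arccos` does not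
truncate. -/
theorem cos_comparisonAngle {p x q : X} (hp : p ≠ x) (hq : q ≠ x) :
    Real.cos (comparisonAngle p x q) =
      (dist x p ^ 2 + dist x q ^ 2 - dist p q ^ 2) / (2 * dist x p * dist x q) := by
  have hp' := dist_pos.2 hp.symm
  have hq' := dist_pos.2 hq.symm
  have h1 := dist_triangle x p q
  have h2 := dist_triangle x q p
  have h3 := dist_triangle p x q
  rw [dist_comm q p] at h2
  rw [dist_comm p x] at h3
  refine Real.cos_arccos ?_ ?_
  · rw [le_div_iff₀ (by positivity)]
    nlinarith [dist_nonneg (x := p) (y := q)]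
  · rw [div_le_iff₀ (by positivity)]
    nlinarith [mul_nonneg (sub_nonneg.2 h1) (sub_nonneg.2 h2)]

/-- The law of cosines inequality in a CAT(0) space. -/
theorem IsCAT0.law_cos (hX : IsCAT0 X) {x p q : X} (hp : p ≠ x) (hq : q ≠ x) :
    dist p x ^ 2 + dist x q ^ 2 - 2 * dist x q * (dist p x * Real.cos (angle p x q)) ≤
      dist p q ^ 2 := by
  have hp' := dist_pos.2 hp.symm
  have hq' := dist_pos.2 hq.symm
  have h := Real.cos_le_cos_of_nonneg_of_le_pi (pathAngle_nonneg _ _)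
    (comparisonAngle_mem_Icc p x q).2 (hX.angle_le_comparisonAngle hp hq)
  rw [cos_comparisonAngle hp hq, div_le_iff₀ (by positivity)] at h
  rw [dist_comm p x]
  change _ ≤ Real.cos (angle p x q) * _ at h
  linarith

end CAT0

/-! ### Convex combinations by separation -/

section Weights

/-- A theorem of the alternative: if a finite family of functions that are jointly convexlike is
nowhere simultaneously negative, then some convex combination of it is nonnegative. -/
theorem exists_weights_nonneg {ι Y : Type*} [Fintype ι] [Nonempty Y] (g : ι → Y → ℝ)
    (hconv : ∀ y z, ∀ t ∈ Set.Icc (0 : ℝ) 1,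
      ∃ m, ∀ i, g i m ≤ (1 - t) * g i y + t * g i z)
    (hg : ∀ y, ∃ i, 0 ≤ g i y) :
    ∃ w ∈ stdSimplex ℝ ι, ∀ y, 0 ≤ ∑ i, w i * g i y := by
  classical
  -- Separate the open negative orthant from the upward closure of the image of `g`. Taking the
  -- closure makes `S` convex although `g` is only convexlike.
  set N : Set (ι → ℝ) := Set.univ.pi fun _ => Set.Iio 0
  set S : Set (ι → ℝ) := {v | ∃ y, ∀ i, g i y ≤ v i}
  have hNconv : Convex ℝ N := convex_pi fun _ _ => convex_Iio 0
  have hNopen : IsOpen N := isOpen_set_pi Set.finite_univ fun _ _ => isOpen_Iio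
  have hSconv : Convex ℝ S := by
    rintro v ⟨y, hy⟩ v' ⟨z, hz⟩ a b ha hb hab
    obtain ⟨m, hm⟩ := hconv y z b ⟨hb, by linarith⟩
    refine ⟨m, fun i => (hm i).trans ?_⟩
    have ha' : 1 - b = a := by linarith
    rw [ha']
    exact add_le_add (mul_le_mul_of_nonneg_left (hy i) ha) (mul_le_mul_of_nonneg_left (hz i) hb)
  have hdisj : Disjoint N S := by
    rw [Set.disjoint_left]
    rintro v hv ⟨y, hy⟩
    obtain ⟨i, hi⟩ := hg y
    exact absurd (hv i trivial) (not_lt.2 (hi.trans (hy i)))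
  obtain ⟨f, u, hfN, hfS⟩ := geometric_hahn_banach_open hNconv hNopen hSconv hdisj
  have hf : ∀ v, f v = ∑ i, f (Pi.single i 1) * v i := fun v => by
    conv_lhs => rw [pi_eq_sum_univ' v]
    simp [map_sum, mul_comm]
  have hmem : ∀ y, (fun i => g i y) ∈ S := fun y => ⟨y, fun _ => le_rfl⟩
  obtain ⟨y₀⟩ := ‹Nonempty Y›
  -- `N` is a cone: if `u < 0`, rescaling `-1` gives a point of `N` where `f` equals `u`.
  have hu : 0 ≤ u := by
    by_contra! hu
    have h1 := hfN (fun _ => -1) (fun i _ => by simp)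
    set K := f (fun _ => (-1 : ℝ))
    have hK : K < 0 := h1.trans hu
    have h2 := hfN ((u / K) • fun _ => (-1 : ℝ)) (fun i _ => by
      have := div_pos_of_neg_of_neg hu hK
      simpa using this)
    rw [map_smul, smul_eq_mul, div_mul_cancel₀ _ hK.ne] at h2
    exact lt_irrefl _ h2
  have hw : ∀ i, 0 ≤ f (Pi.single i 1) := by
    intro i
    by_contra! hi
    set c := f (Pi.single i 1)
    have h0 := hfS _ (hmem y₀)
    set b := f fun i => g i y₀
    -- `S` is closed upwards; this shift along the `i`-th axis lowers `f` from `b` to `-1`, below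
    -- `u`.
    have h1 := hfS ((fun j => g j y₀) + ((b + 1) / -c) • Pi.single i 1) ⟨y₀, fun j => by
      have : 0 ≤ (b + 1) / -c := div_nonneg (by linarith) (by linarith)
      by_cases h : j = i
      · subst h; simpa using this
      · simp [h]⟩
    rw [map_add, map_smul, smul_eq_mul] at h1
    have : (b + 1) / -c * c = -(b + 1) := by
      rw [div_neg, neg_mul, div_mul_cancel₀ _ hi.ne]
    change u ≤ b + (b + 1) / -c * c at h1
    linarith
  -- Otherwise `f = 0`, and separation would give both `0 < u` and `u ≤ 0`.
  have hpos : 0 < ∑ i, f (Pi.single i 1) := by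
    refine (Finset.sum_nonneg fun i _ => hw i).lt_of_ne fun h0 => ?_
    have hz : ∀ i, f (Pi.single i 1) = 0 := fun i =>
      (Finset.sum_eq_zero_iff_of_nonneg fun i _ => hw i).1 h0.symm i (Finset.mem_univ i)
    have h1 := hfN (fun _ => -1) (fun i _ => by simp)
    have h2 := hfS _ (hmem y₀)
    rw [hf] at h1 h2
    simp only [hz, zero_mul, Finset.sum_const_zero] at h1 h2
    linarith
  refine ⟨fun i => f (Pi.single i 1) / ∑ j, f (Pi.single j 1),
    ⟨fun i => div_nonneg (hw i) hpos.le, ?_⟩, fun y => ?_⟩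
  · rw [← Finset.sum_div, div_self hpos.ne']
  · have h := hu.trans (hfS _ (hmem y))
    rw [hf] at h
    simp only [div_mul_eq_mul_div, ← Finset.sum_div]
    exact div_nonneg h hpos.le

end Weights

/-! ### Existence of minimizers -/

section Minimizers

variable {X : Type*} [MetricSpace X]

/-- A continuous function on a complete space that is bounded below and uniformly midpoint convex
attains its minimum. -/
theorem exists_isMinOn_of_midpoint [CompleteSpace X] [Nonempty X] {F : X → ℝ}
    (hF : Continuous F) (hbdd : BddBelow (Set.range F))
    (hmid : ∀ y z, ∃ m, F m ≤ (F y + F z) / 2 - dist y z ^ 2 / 4) :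
    ∃ x, ∀ y, F x ≤ F y := by
  have hlow : ∀ y, sInf (Set.range F) ≤ F y := fun y => csInf_le hbdd ⟨y, rfl⟩
  have hex : ∀ n : ℕ, ∃ y, F y < sInf (Set.range F) + 1 / ((n : ℝ) + 1) := fun n => by
    obtain ⟨_, ⟨y, rfl⟩, hy⟩ := exists_lt_of_csInf_lt (Set.range_nonempty F)
      (lt_add_of_pos_right (sInf (Set.range F)) (Nat.one_div_pos_of_nat (α := ℝ) (n := n)))
    exact ⟨y, hy⟩
  choose y hy using hex
  have hlim := tendsto_one_div_add_atTop_nhds_zero_nat (𝕜 := ℝ)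
  have hcauchy : CauchySeq y := by
    -- The midpoint value is at least the infimum, so `d(y n, y k)² / 4` is at most the mean excess
    -- over it, hence at most `1 / (N + 1)`.
    refine cauchySeq_of_le_tendsto_0 (fun n : ℕ => Real.sqrt (4 * (1 / ((n : ℝ) + 1)))) ?_ ?_
    · intro n k N hn hk
      refine Real.le_sqrt_of_sq_le ?_
      obtain ⟨m, hm⟩ := hmid (y n) (y k)
      have h1 := Nat.one_div_le_one_div (α := ℝ) hn
      have h2 := Nat.one_div_le_one_div (α := ℝ) hk
      linarith [hlow m, hy n, hy k]
    · simpa using (hlim.const_mul 4).sqrt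
  obtain ⟨x, hx⟩ := cauchySeq_tendsto_of_complete hcauchy
  refine ⟨x, fun z => le_trans ?_ (hlow z)⟩
  have h := hlim.const_add (sInf (Set.range F))
  rw [add_zero] at h
  exact le_of_tendsto_of_tendsto' ((hF.tendsto x).comp hx) h fun n => (hy n).le

end Minimizers

/-! ### Mean deficit and mean set -/

section MeanSet

variable {X : Type*} [MetricSpace X]

theorem meanDeficit_nonneg (A : Finset X) (hA : A.Nonempty) (x : X) : 0 ≤ meanDeficit A hA x :=
  le_max_right _ _

/-- The finite minimum is attained, and `dist b x` for any `b ∈ A` bounds the family above, so its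
real supremum is a genuine upper bound. -/
theorem exists_mul_cos_angle_le_meanDeficit (A : Finset X) (hA : A.Nonempty) {x y : X}
    (hy : y ≠ x) :
    ∃ a ∈ A, dist a x * Real.cos (angle a x y) ≤ meanDeficit A hA x := by
  obtain ⟨a, ha, h⟩ := A.exists_mem_eq_inf' hA fun a => dist a x * Real.cos (angle a x y)
  refine ⟨a, ha, h ▸ le_max_of_le_left ?_⟩
  refine le_ciSup (f := fun y : {y : X // y ≠ x} =>
    A.inf' hA fun a => dist a x * Real.cos (angle a x y)) ?_ ⟨y, hy⟩
  obtain ⟨b, hb⟩ := hA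
  refine ⟨dist b x, ?_⟩
  rintro _ ⟨z, rfl⟩
  exact (Finset.inf'_le _ hb).trans (mul_le_of_le_one_right dist_nonneg (Real.cos_le_one _))

/-- Moving away from `x` cannot decrease all squared distances to the points of `A` by more than
the square of the mean deficit. -/
theorem IsCAT0.exists_dist_sq_ge (hX : IsCAT0 X) (A : Finset X) (hA : A.Nonempty) {x : X}
    (hx : x ∉ A) (y : X) :
    ∃ a : A, 0 ≤ dist (a : X) y ^ 2 - dist (a : X) x ^ 2 + meanDeficit A hA x ^ 2 := by
  by_cases hy : y = x
  · obtain ⟨a, ha⟩ := hA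
    exact ⟨⟨a, ha⟩, by rw [hy]; nlinarith [sq_nonneg (meanDeficit A ⟨a, ha⟩ x)]⟩
  · obtain ⟨a, ha, h⟩ := exists_mul_cos_angle_le_meanDeficit A hA hy
    have hax : a ≠ x := fun h => hx (h ▸ ha)
    refine ⟨⟨a, ha⟩, ?_⟩
    have h1 := hX.law_cos hax hy
    have h2 := mul_le_mul_of_nonneg_left h (dist_nonneg (x := x) (y := y))
    -- Completing the square: `d² - 2 d ε ≥ -ε²`.
    have h3 := sq_nonneg (dist x y - meanDeficit A hA x)
    change 0 ≤ dist a y ^ 2 - dist a x ^ 2 + _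
    linarith

/-- One geodesic midpoint serves all `a` at once, and weights of total `1` preserve the quadratic
gain. This gives both the minimizer and the estimate of its distance to `x`. -/
theorem IsCAT0.exists_sum_dist_sq_le (hX : IsCAT0 X) (A : Finset X) {w : A → ℝ}
    (hw : w ∈ stdSimplex ℝ A) (y z : X) :
    ∃ m, ∑ a : A, w a * dist (a : X) m ^ 2 ≤
      (∑ a : A, w a * dist (a : X) y ^ 2 + ∑ a : A, w a * dist (a : X) z ^ 2) / 2 -
        dist y z ^ 2 / 4 := by
  obtain ⟨m, hm⟩ := hX.exists_dist_sq_le y z (t := 1 / 2) ⟨by norm_num, by norm_num⟩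
  refine ⟨m, ?_⟩
  calc ∑ a : A, w a * dist (a : X) m ^ 2
      ≤ ∑ a : A, w a * ((1 - 1 / 2) * dist (a : X) y ^ 2 + 1 / 2 * dist (a : X) z ^ 2 -
          1 / 2 * (1 - 1 / 2) * dist y z ^ 2) :=
        Finset.sum_le_sum fun a _ => mul_le_mul_of_nonneg_left (hm a) (hw.1 a)
    _ = ∑ a : A, (w a * dist (a : X) y ^ 2 * (1 / 2) + w a * dist (a : X) z ^ 2 * (1 / 2) -
          w a * (dist y z ^ 2 / 4)) := Finset.sum_congr rfl fun a _ => by ring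
    _ = _ := by
        rw [Finset.sum_sub_distrib, Finset.sum_add_distrib, ← Finset.sum_mul, ← Finset.sum_mul,
          ← Finset.sum_mul, hw.2]
        ring

/-- In a Hadamard space, the mean deficit controls the distance to the mean set. -/
theorem IsHadamardSpace.exists_mem_meanSet_dist_le (hX : IsHadamardSpace X) (A : Finset X)
    (hA : A.Nonempty) {x : X} (hx : x ∉ A) :
    ∃ z ∈ meanSet A, dist x z ≤ 2 * meanDeficit A hA x := by
  have := hX.complete
  have : Nonempty X := ⟨x⟩
  set ε := meanDeficit A hA x
  have hε0 : 0 ≤ ε := meanDeficit_nonneg A hA x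
  obtain ⟨w, hw, hnn⟩ := exists_weights_nonneg
    (fun (a : A) y => dist (a : X) y ^ 2 - dist (a : X) x ^ 2 + ε ^ 2)
    (fun y z t ht => by
      obtain ⟨m, hm⟩ := hX.cat0.exists_dist_sq_le y z ht
      refine ⟨m, fun a => ?_⟩
      have h := mul_nonneg (mul_nonneg ht.1 (sub_nonneg.2 ht.2)) (sq_nonneg (dist y z))
      linarith [hm a])
    (hX.cat0.exists_dist_sq_ge A hA hx)
  obtain ⟨z, hz⟩ := exists_isMinOn_of_midpoint (F := fun y => ∑ a : A, w a * dist (a : X) y ^ 2)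
    (by fun_prop)
    ⟨0, by
      rintro _ ⟨y, rfl⟩
      exact Finset.sum_nonneg fun a _ => mul_nonneg (hw.1 a) (sq_nonneg _)⟩
    (hX.cat0.exists_sum_dist_sq_le A hw)
  refine ⟨z, ⟨w, hw, hz⟩, ?_⟩
  obtain ⟨m, hm⟩ := hX.cat0.exists_sum_dist_sq_le A hw x z
  have h1 := hz m
  have h2 := hnn z
  simp only [mul_add, mul_sub, Finset.sum_add_distrib, Finset.sum_sub_distrib,
    ← Finset.sum_mul, hw.2, one_mul] at h2
  -- With `F z ≤ F m` and `F x - F z ≤ ε²`, the midpoint inequality gives `d(x,z)² ≤ 2 (F x - F z) ≤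
  -- 2 ε² ≤ (2 ε)²`.
  refine abs_le_of_sq_le_sq' ?_ (by positivity) |>.2
  nlinarith [sq_nonneg ε]

end MeanSet

end HadamardMean

theorem mainTheorem12 {X : Type*} [MetricSpace X] [LocallyCompactSpace X]
    (hX : HadamardMean.IsHadamardSpace X) (A : Finset X) (hA : A.Nonempty)
    (x : ℕ → X) (hx : ∀ r, x r ∉ A)
    (hdef : Tendsto (fun r => HadamardMean.meanDeficit A hA (x r)) atTop (𝓝 0)) :
    Tendsto (fun r => Metric.infEDist (x r) (HadamardMean.meanSet A)) atTop (𝓝 0) := by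
  have hlim : Tendsto (fun r => ENNReal.ofReal (2 * HadamardMean.meanDeficit A hA (x r))) atTop
      (𝓝 0) := by
    simpa using ENNReal.tendsto_ofReal (hdef.const_mul 2)
  refine tendsto_of_tendsto_of_tendsto_of_le_of_le tendsto_const_nhds hlim (fun _ => zero_le)
    fun r => ?_
  obtain ⟨z, hz, hle⟩ := hX.exists_mem_meanSet_dist_le A hA (hx r)
  refine (Metric.infEDist_le_edist_of_mem hz).trans ?_
  rw [edist_dist]
  exact ENNReal.ofReal_le_ofReal hle
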